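/- For a permutation $f$ of $\{0,1\}^n$ let $\tilde f(y,x)=(f(y),x)$, and let $h(y,x)=y\cdot x$ be the inner product modulo two, for $x,y\in\{0,1\}^n$. A function $G:\{0,1\}^n\times\{0,1\}^n\to\{0,1\}$ *$(\delta,\varepsilon)$-predicts $h$ from $\tilde f$* if $$\Pr_y\Big[\Pr_x[G(\tilde f(y,x))=h(y,x)]\ge \tfrac12+\varepsilon\Big]\ge\delta ,$$ where $x,y$ are uniform in $\{0,1\}^n$. In the classical GL$^*$ problem with parameters $n,\delta,\varepsilon$, a classical probabilistic query algorithm (a random adaptive decision tree, with unrestricted computation) receives $b=f(a)$, where $f$ is a uniformly random permutation of $\{0,1\}^n$ and $a\in\{0,1\}^n$ is uniformly random and independent of $f$. It may make $f$-queries (input $y$, answer $f(y)$) and $G$-queries (input $(y,x)$, answer $G_f(y,x)$), and it must output $a$. It solves the problem if, for every assignment $f\mapsto G_f$ of functions such that $G_f$ $(\delta,\varepsilon)$-predicts $h$ from $\tilde f$ for every $f$, its success probability over $f$, $a$ and its own coins is at least $\delta/2$. **Theorem.** There is an absolute constant $c>0$ such that, for all $n$, all $\delta$ with $2^{-n/2}\le\delta\le1$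 and all $\varepsilon$ with $\sqrt n\,2^{-n/4}\le\varepsilon\le\frac12$, every classical algorithm that solves the GL$^*$ problem with parameters $n,\delta,\varepsilon$, making in every run at most $T_f$ $f$-queries and at most $T_G$ $G$-queries, satisfies $$T_f\ge c\,2^{n/2}\qquad\text{or}\qquad T_G\ge c\,\frac{n}{\varepsilon^2}.$$ (For $n=0$ the second inequality is read as $T_G\ge 0$.) -/

import Mathlib

namespace GLStar

/-- Bit strings of length `n`, as vectors over the field with two elements. -/
abbrev Bits (n : ℕ) : Type := Fin n → ZMod 2

/-- Probability of the event `p` for a uniformly random element of a finite type. -/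
noncomputable def prob {α : Type*} [Fintype α] (p : α → Prop) : ℝ :=
  (Nat.card {a : α // p a} : ℝ) / (Fintype.card α : ℝ)

/-- The predicate `h(y, x) = y · x`, the inner product modulo two. -/
def h {n : ℕ} (p : Bits n × Bits n) : ZMod 2 := p.1 ⬝ᵥ p.2

/-- The permutation `(y, x) ↦ (f y, x)` attached to a permutation `f`. -/
def tilde {n : ℕ} (f : Equiv.Perm (Bits n)) : Equiv.Perm (Bits n × Bits n) :=
  Equiv.prodCongr f (Equiv.refl (Bits n))

/-- `y` is `ε`-good for `G`: `Pr_x [G (f̃ (y, x)) = h (y, x)] ≥ 1/2 + ε`. -/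
def IsGood {n : ℕ} (ε : ℝ) (f : Equiv.Perm (Bits n)) (G : Bits n × Bits n → ZMod 2)
    (y : Bits n) : Prop :=
  1 / 2 + ε ≤ prob fun x : Bits n => G (tilde f (y, x)) = h (y, x)

/-- `G` `(δ, ε)`-predicts `h` from `f̃`: `Pr_y [y is ε-good] ≥ δ`. -/
def Predicts {n : ℕ} (δ ε : ℝ) (f : Equiv.Perm (Bits n)) (G : Bits n × Bits n → ZMod 2) : Prop :=
  δ ≤ prob fun y : Bits n => IsGood ε f G y

/-- Deterministic adaptive query algorithms (decision trees). The next step may depend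
arbitrarily on all the answers obtained so far. -/
inductive QueryTree (n : ℕ) : Type
  | output (a : Bits n) : QueryTree n
  | queryF (y : Bits n) (next : Bits n → QueryTree n) : QueryTree n
  | queryG (p : Bits n × Bits n) (next : ZMod 2 → QueryTree n) : QueryTree n

namespace QueryTree

variable {n : ℕ}

/-- The output of a decision tree when the queries are answered by `f` and `G`. -/
def run (f : Equiv.Perm (Bits n)) (G : Bits n × Bits n → ZMod 2) : QueryTree n → Bits n
  | output a => a
  | queryF y next => run f G (next (f y))
  | queryG p next => run f G (next (G p))

/-- The number of `f`-queries made when the queries are answered by `f` and `G`. -/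
def numF (f : Equiv.Perm (Bits n)) (G : Bits n × Bits n → ZMod 2) : QueryTree n → ℕ
  | output _ => 0
  | queryF y next => numF f G (next (f y)) + 1
  | queryG p next => numF f G (next (G p))

/-- The number of `G`-queries made when the queries are answered by `f` and `G`. -/
def numG (f : Equiv.Perm (Bits n)) (G : Bits n × Bits n → ZMod 2) : QueryTree n → ℕ
  | output _ => 0
  | queryF y next => numG f G (next (f y))
  | queryG p next => numG f G (next (G p)) + 1

end QueryTree

/-- A deterministic algorithm: the problem instance `b` determines the decision tree. -/
abbrev DetAlg (n : ℕ) : Type := Bits n → QueryTree n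

/-- A classical probabilistic algorithm: a random deterministic one, chosen independently of
the problem instance and of the black boxes. -/
abbrev RandAlg (n : ℕ) : Type := PMF (DetAlg n)

/-- The probability, over a uniformly random permutation `f`, a uniformly random `a` and the
coins of the algorithm, that on input `b = f a`, with black boxes `f` and `G f`, it outputs `a`.
The predictor may depend on `f`, but neither on `a` nor on the coins. -/
noncomputable def successProb {n : ℕ} (A : RandAlg n)
    (G : Equiv.Perm (Bits n) → Bits n × Bits n → ZMod 2) : ℝ :=
  ∑' D : DetAlg n, (A D).toReal *
    prob fun q : Equiv.Perm (Bits n) × Bits n => (D (q.1 q.2)).run q.1 (G q.1) = q.2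

/-- `A` solves the GL* problem with parameters `δ, ε`: whatever `(δ, ε)`-predictors are supplied,
it inverts a random permutation at a random point with probability at least `δ / 2`. -/
def Solves {n : ℕ} (δ ε : ℝ) (A : RandAlg n) : Prop :=
  ∀ G : Equiv.Perm (Bits n) → Bits n × Bits n → ZMod 2,
    (∀ f, Predicts δ ε f (G f)) → δ / 2 ≤ successProb A G

/-- In every run of the GL* problem, whatever the coins, `A` makes at most `TF` `f`-queries and at
most `TG` `G`-queries. -/
def QueryBound {n : ℕ} (δ ε : ℝ) (A : RandAlg n) (TF TG : ℕ) : Prop :=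
  ∀ D ∈ A.support, ∀ (f : Equiv.Perm (Bits n)) (G : Bits n × Bits n → ZMod 2) (a : Bits n),
    Predicts δ ε f G → (D (f a)).numF f G ≤ TF ∧ (D (f a)).numG f G ≤ TG

end GLStar

/-! Against every algorithm there is a bad family of predictors, found by averaging over random
ones. Write `N` for `2^n`. Fix a set `B` of about `δN` images, independent of `f`. On rows in `B`,
let each value be independently correct with probability `1/2 + β`, where `β ≤ 2ε`; all other values
are uniform bits. By Chernoff and a union bound over rows, such a table predicts with probability at
least `1/2` for each `f` (`exists_bias_predicts`). If `b ∉ B`, the table carries no information on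
the preimage of `b`. Exchanging that preimage with a random point is noticed only if the run touches
the point or the row of its image, so success is at most `ρ`, of order `(T_f + T_G)/N`
(`card_mem_points_le`). If `b ∈ B`, compare with the table whose row `b` has been made uniform. Each
`G`-query costs a factor `1 + 4β²` in the second moment, so success is at most `√((1 + 4β²)^T_G ·
ρ)` (`sq_sum_mass_mem_points_le`), which is at most a small constant `γ` while `T_G` is far below
`n/ε²`. In total success is at most `ρ + γ|B|/N`, a small multiple of `δ`. Conditioning on the table
predicting costs a factor `2`, and some choice of tables does no worse than the conditional average
(`exists_predicts_successProb_le`). -/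

namespace GLStar

/-! ### Query trees: truncation and exchange of preimages -/

namespace QueryTree

variable {n : ℕ}

/-- The tree makes at most `s` `f`-queries and at most `m` `G`-queries on every branch. -/
inductive Within : ℕ → ℕ → QueryTree n → Prop
  | output (s m : ℕ) (a : Bits n) : Within s m (.output a)
  | queryF {s m : ℕ} {y : Bits n} {next : Bits n → QueryTree n}
      (h : ∀ z, Within s m (next z)) : Within (s + 1) m (.queryF y next)
  | queryG {s m : ℕ} {p : Bits n × Bits n} {next : ZMod 2 → QueryTree n}
      (h : ∀ v, Within s m (next v)) : Within s (m + 1) (.queryG p next)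

/-- Stop as soon as more than `s` `f`-queries or more than `m` `G`-queries would be made. -/
def trunc : QueryTree n → ℕ → ℕ → QueryTree n
  | .output a, _, _ => .output a
  | .queryF _ _, 0, _ => .output 0
  | .queryF y next, s + 1, m => .queryF y fun z => trunc (next z) s m
  | .queryG _ _, _, 0 => .output 0
  | .queryG p next, s, m + 1 => .queryG p fun v => trunc (next v) s m

theorem within_trunc (t : QueryTree n) : ∀ s m : ℕ, Within s m (t.trunc s m) := by
  induction t with
  | output a => intro s m; simp only [trunc]; exact .output s m a
  | queryF y next ih =>
    intro s m
    cases s with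
    | zero => simp only [trunc]; exact .output 0 m 0
    | succ s => simp only [trunc]; exact .queryF fun z => ih z s m
  | queryG p next ih =>
    intro s m
    cases m with
    | zero => simp only [trunc]; exact .output s 0 0
    | succ m => simp only [trunc]; exact .queryG fun z => ih z s m

/-- The query bounds are assumed only for tables that predict, whereas a random table may fail to.
Truncation bounds every run and leaves the relevant ones unchanged. -/
theorem run_trunc (f : Equiv.Perm (Bits n)) (G : Bits n × Bits n → ZMod 2) (t : QueryTree n) :
    ∀ s m : ℕ, numF f G t ≤ s → numG f G t ≤ m → run f G (t.trunc s m) = run f G t := by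
  induction t with
  | output a => intro s m _ _; simp only [trunc]
  | queryF y next ih =>
    intro s m hs hm
    cases s with
    | zero => simp [numF] at hs
    | succ s =>
      simp only [numF, numG] at hs hm
      simp only [trunc, run]
      exact ih _ s m (by omega) hm
  | queryG p next ih =>
    intro s m hs hm
    cases m with
    | zero => simp [numG] at hm
    | succ m =>
      simp only [numF, numG] at hs hm
      simp only [trunc, run]
      exact ih _ s m hs (by omega)

/-- The points at which `f` is queried, together with the output. -/
def points (f : Equiv.Perm (Bits n)) (G : Bits n × Bits n → ZMod 2) :
    QueryTree n → Finset (Bits n)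
  | .output a => {a}
  | .queryF y next => insert y (points f G (next (f y)))
  | .queryG p next => points f G (next (G p))

/-- The first components of the `G`-queries. -/
def rows (f : Equiv.Perm (Bits n)) (G : Bits n × Bits n → ZMod 2) :
    QueryTree n → Finset (Bits n)
  | .output _ => ∅
  | .queryF y next => rows f G (next (f y))
  | .queryG p next => insert p.1 (rows f G (next (G p)))

theorem run_mem_points (f : Equiv.Perm (Bits n)) (G : Bits n × Bits n → ZMod 2)
    (t : QueryTree n) : run f G t ∈ points f G t := by
  induction t with
  | output a => simp [run, points]
  | queryF y next ih => exact Finset.mem_insert_of_mem (ih _)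
  | queryG p next ih => exact ih _

theorem card_points_le (f : Equiv.Perm (Bits n)) (G : Bits n × Bits n → ZMod 2)
    {s m : ℕ} {t : QueryTree n} (ht : Within s m t) : (points f G t).card ≤ s + 1 := by
  induction ht with
  | output s m a => simp [points]
  | queryF h ih => exact (Finset.card_insert_le _ _).trans (Nat.succ_le_succ (ih _))
  | queryG h ih => exact ih _

theorem card_rows_le (f : Equiv.Perm (Bits n)) (G : Bits n × Bits n → ZMod 2)
    {s m : ℕ} {t : QueryTree n} (ht : Within s m t) : (rows f G t).card ≤ m := by
  induction ht with
  | output s m a => simp [rows]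
  | queryF h ih => exact ih _
  | queryG h ih => exact (Finset.card_insert_le _ _).trans (Nat.succ_le_succ (ih _))

/-- Two runs agree until one of the places where the oracles differ is touched. -/
theorem mem_points_of_agree {f f' : Equiv.Perm (Bits n)} {G G' : Bits n × Bits n → ZMod 2}
    {a a₀ z₀ : Bits n} (hf : ∀ y, y ≠ a → y ≠ a₀ → f' y = f y)
    (hG : ∀ p : Bits n × Bits n, p.1 ≠ z₀ → G' p = G p) (t : QueryTree n)
    (ha : a ∈ points f G t) (ha₀ : a₀ ∉ points f G t) (hz₀ : z₀ ∉ rows f G t) :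
    a ∈ points f' G' t := by
  induction t with
  | output o => exact ha
  | queryF y next ih =>
    simp only [points, rows, Finset.mem_insert, not_or] at ha ha₀ hz₀ ⊢
    by_cases hy : a = y
    · exact Or.inl hy
    · rw [hf y (Ne.symm hy) (Ne.symm ha₀.1)]
      exact Or.inr (ih _ (ha.resolve_left hy) ha₀.2 hz₀)
  | queryG p next ih =>
    simp only [points, rows, Finset.mem_insert, not_or] at ha ha₀ hz₀ ⊢
    rw [hG p (Ne.symm hz₀.1)]
    exact ih _ ha ha₀ hz₀.2

/-- If the predictor at `b` is independent of the preimage of `b`, few permutations have their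
preimage of `b` touched. -/
theorem card_mem_points_le (b : Bits n) (G : Equiv.Perm (Bits n) → Bits n × Bits n → ZMod 2)
    (hG : ∀ f a₀ p, p.1 ≠ f a₀ → G (f * Equiv.swap (f.symm b) a₀) p = G f p)
    {s m : ℕ} {t : QueryTree n} (ht : Within s m t) :
    (Finset.univ.filter fun f : Equiv.Perm (Bits n) => f.symm b ∈ points f (G f) t).card
        * Fintype.card (Bits n)
      ≤ 2 * ((s + 1 + m) * Fintype.card (Equiv.Perm (Bits n))) := by
  classical
  -- Pairs in which the run notices the point `a₀` or the row of its image.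
  let bad : Finset (Equiv.Perm (Bits n) × Bits n) :=
    Finset.univ.filter fun q => q.2 ∈ points q.1 (G q.1) t ∨ q.1 q.2 ∈ rows q.1 (G q.1) t
  let τ : Equiv.Perm (Bits n) × Bits n → Equiv.Perm (Bits n) × Bits n :=
    fun q => (q.1 * Equiv.swap (q.1.symm b) q.2, q.1.symm b)
  have hτ : Function.Involutive τ := by
    rintro ⟨f, a₀⟩
    have h1 : (f * Equiv.swap (f.symm b) a₀).symm b = a₀ := by
      rw [Equiv.symm_apply_eq]; simp
    simp only [τ, h1, Prod.mk.injEq, and_true]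
    rw [Equiv.swap_comm a₀, mul_assoc, Equiv.swap_mul_self, mul_one]
  have hbad : bad.card ≤ (s + 1 + m) * Fintype.card (Equiv.Perm (Bits n)) := by
    have : bad ⊆ (Finset.univ.sigma fun f : Equiv.Perm (Bits n) =>
        points f (G f) t ∪ (rows f (G f) t).image f.symm).image
          (fun q => ((q.1, q.2) : Equiv.Perm (Bits n) × Bits n)) := by
      rintro ⟨f, a₀⟩ hq
      simp only [bad, Finset.mem_filter, Finset.mem_univ, true_and] at hq
      refine Finset.mem_image.2 ⟨⟨f, a₀⟩, ?_, rfl⟩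
      simp only [Finset.mem_sigma, Finset.mem_univ, true_and, Finset.mem_union, Finset.mem_image]
      exact hq.imp id fun h => ⟨_, h, f.symm_apply_apply a₀⟩
    refine (Finset.card_le_card this).trans (Finset.card_image_le.trans ?_)
    rw [Finset.card_sigma, mul_comm, ← smul_eq_mul]
    refine Finset.sum_le_card_nsmul _ _ _ fun f _ => (Finset.card_union_le _ _).trans ?_
    exact Nat.add_le_add (card_points_le f _ ht) (Finset.card_image_le.trans (card_rows_le f _ ht))
  -- If the run for `f` touches the preimage `a` of `b` but does not notice `a₀`, then the run for
  -- the exchanged permutation also touches `a`. There `a` is the second component of the image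
  -- under `τ`, so that image is bad.
  have hcov : (Finset.univ.filter fun f : Equiv.Perm (Bits n) => f.symm b ∈ points f (G f) t)
      ×ˢ (Finset.univ : Finset (Bits n)) ⊆ bad ∪ bad.image τ := by
    rintro ⟨f, a₀⟩ hq
    simp only [Finset.mem_product, Finset.mem_filter, Finset.mem_univ, true_and, and_true] at hq
    by_cases hb : (f, a₀) ∈ bad
    · exact Finset.mem_union_left _ hb
    refine Finset.mem_union_right _ (Finset.mem_image.2 ⟨τ (f, a₀), ?_, hτ _⟩)
    simp only [bad, Finset.mem_filter, Finset.mem_univ, true_and, not_or] at hb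
    simp only [bad, τ, Finset.mem_filter, Finset.mem_univ, true_and]
    refine Or.inl (mem_points_of_agree (a₀ := a₀) (z₀ := f a₀) ?_ (hG f a₀) t hq hb.1 hb.2)
    intro y h1 h2
    simp [Equiv.swap_apply_of_ne_of_ne h1 h2]
  have := (Finset.card_le_card hcov).trans (Finset.card_union_le _ _)
  rw [Finset.card_product, Finset.card_univ] at this
  have h2 : (bad.image τ).card ≤ bad.card := Finset.card_image_le
  omega

end QueryTree


/-! ### Product measures on tables -/

/-- The weight of `g` under the product of the weights `k i` on bits. -/
noncomputable def mass {I : Type*} [Fintype I] (k : I → ZMod 2 → ℝ) (g : I → ZMod 2) : ℝ :=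
  ∏ i, k i (g i)

theorem mass_nonneg {I : Type*} [Fintype I] {k : I → ZMod 2 → ℝ} (hk : ∀ i v, 0 ≤ k i v) (g : I → ZMod 2) :
    0 ≤ mass k g :=
  Finset.prod_nonneg fun i _ => hk i _

section mass

variable {I : Type*} [Fintype I] [DecidableEq I]

theorem sum_mass (k : I → ZMod 2 → ℝ) : ∑ g, mass k g = ∏ i, ∑ v, k i v := by
  rw [Finset.prod_univ_sum, Fintype.piFinset_univ]
  rfl

theorem sum_mass_eq_one {k : I → ZMod 2 → ℝ} (hk : ∀ i, ∑ v, k i v = 1) :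
    ∑ g, mass k g = 1 := by
  rw [sum_mass, Finset.prod_eq_one fun i _ => hk i]

theorem mass_update (k : I → ZMod 2 → ℝ) (i : I) (v : ZMod 2) (g : I → ZMod 2) :
    mass (Function.update k i (Pi.single v 1)) g =
      if g i = v then ∏ j ∈ Finset.univ.erase i, k j (g j) else 0 := by
  rw [mass, ← Finset.mul_prod_erase _ _ (Finset.mem_univ i), Function.update_self,
    Finset.prod_congr rfl fun j hj => by rw [Function.update_of_ne (Finset.ne_of_mem_erase hj)]]
  by_cases h : g i = v
  · simp [h]
  · simp [h]

/-- Conditioning on one coordinate. -/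
theorem sum_mass_mul_eq (k : I → ZMod 2 → ℝ) (i : I) (F : (I → ZMod 2) → ℝ) :
    ∑ g, mass k g * F g =
      ∑ v, k i v * ∑ g, mass (Function.update k i (Pi.single v 1)) g * F g := by
  simp_rw [Finset.mul_sum]
  rw [Finset.sum_comm]
  refine Finset.sum_congr rfl fun g _ => ?_
  simp_rw [mass_update]
  rw [Finset.sum_eq_single (g i)]
  · rw [if_pos rfl, mass, ← Finset.mul_prod_erase _ _ (Finset.mem_univ i), mul_assoc]
  · intro v _ hv; rw [if_neg (Ne.symm hv)]; simp
  · simp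

/-- Conditioned on the value `v` of the coordinate `i`, functions agreeing there have the same
mean. -/
theorem sum_mass_update_congr (k : I → ZMod 2 → ℝ) (i : I) (v : ZMod 2) {F F' : (I → ZMod 2) → ℝ}
    (h : ∀ g, g i = v → F g = F' g) :
    ∑ g, mass (Function.update k i (Pi.single v 1)) g * F g =
      ∑ g, mass (Function.update k i (Pi.single v 1)) g * F' g := by
  refine Finset.sum_congr rfl fun g _ => ?_
  by_cases hg : g i = v
  · rw [h g hg]
  · rw [mass_update, if_neg hg, zero_mul, zero_mul]

end mass

/-! ### Change of measure by the `χ²`-divergence -/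

/-- `k` and `q` have total weight `1` and `q` is nonnegative, and the `χ²`-divergence of `k` from `q` is at
most `κ - 1`. -/
structure ChiBound (κ : ℝ) (k q : ZMod 2 → ℝ) : Prop where
  nonneg : ∀ v, 0 ≤ q v
  sum_eq : ∑ v, k v = 1
  sum_eq' : ∑ v, q v = 1
  sq_le : ∀ u : ZMod 2 → ℝ, (∑ v, k v * u v) ^ 2 ≤ κ * ∑ v, q v * u v ^ 2

theorem sq_sum_mul_le {ι : Type*} [Fintype ι] {k : ι → ℝ} (h0 : ∀ v, 0 ≤ k v)
    (h1 : ∑ v, k v = 1) (u : ι → ℝ) : (∑ v, k v * u v) ^ 2 ≤ ∑ v, k v * u v ^ 2 :=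
  Real.pow_arith_mean_le_arith_mean_pow_of_even _ _ _ (fun v _ => h0 v) h1 even_two

theorem ChiBound.refl {κ : ℝ} (hκ : 1 ≤ κ) {k : ZMod 2 → ℝ} (h0 : ∀ v, 0 ≤ k v)
    (h1 : ∑ v, k v = 1) : ChiBound κ k k where
  nonneg := h0
  sum_eq := h1
  sum_eq' := h1
  sq_le u := by
    have h := sq_sum_mul_le h0 h1 u
    have h2 : 0 ≤ ∑ v, k v * u v ^ 2 := Finset.sum_nonneg fun v _ => mul_nonneg (h0 v) (sq_nonneg _)
    nlinarith

theorem ChiBound.single {κ : ℝ} (hκ : 1 ≤ κ) (v : ZMod 2) :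
    ChiBound κ (Pi.single v 1) (Pi.single v 1) :=
  .refl hκ (fun w => by by_cases h : w = v <;> simp [h])
    (by simp)

/-- The weights of a bit that equals `c` with probability `1 / 2 + β`. -/
noncomputable def coin (β : ℝ) (c v : ZMod 2) : ℝ := if v = c then 1 / 2 + β else 1 / 2 - β

theorem sum_zmod_two (c : ZMod 2) (F : ZMod 2 → ℝ) : ∑ v, F v = F c + F (c + 1) := by
  have : (∑ v, F v) = F 0 + F 1 := Fin.sum_univ_two F
  rw [this]
  obtain rfl | rfl : c = 0 ∨ c = 1 := by decide +revert
  · simp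
  · rw [add_comm, show (1 + 1 : ZMod 2) = 0 by decide]

theorem coin_self (β : ℝ) (c : ZMod 2) : coin β c c = 1 / 2 + β := if_pos rfl

theorem coin_add_one (β : ℝ) (c : ZMod 2) : coin β c (c + 1) = 1 / 2 - β := if_neg (by simp)

theorem coin_zero (c v : ZMod 2) : coin 0 c v = 1 / 2 := by simp [coin]

theorem coin_nonneg {β : ℝ} (h0 : 0 ≤ β) (h1 : β ≤ 1 / 2) (c v : ZMod 2) : 0 ≤ coin β c v := by
  unfold coin; split_ifs <;> linarith

theorem sum_coin (β : ℝ) (c : ZMod 2) : ∑ v, coin β c v = 1 := by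
  rw [sum_zmod_two c, coin_self, coin_add_one]; ring

/-- Cauchy–Schwarz with constant `∑ k²/q = 2((1/2 + β)² + (1/2 - β)²) = 1 + 4β²`; the defect is the
square passed to `nlinarith`. -/
theorem chiBound_coin (β : ℝ) (c c' : ZMod 2) :
    ChiBound (1 + 4 * β ^ 2) (coin β c) (coin 0 c') where
  nonneg := coin_nonneg le_rfl (by norm_num) c'
  sum_eq := sum_coin β c
  sum_eq' := sum_coin 0 c'
  sq_le u := by
    simp only [coin_zero]
    rw [sum_zmod_two c, sum_zmod_two c, coin_self, coin_add_one]
    nlinarith [sq_nonneg ((1 / 2 - β) * u c - (1 / 2 + β) * u (c + 1))]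

namespace QueryTree

variable {n : ℕ}

/-- Change of measure: a tree with few `G`-queries reaches no leaf much more often under `k`
than under `q`. -/
theorem sq_sum_mass_mem_points_le {κ : ℝ} (hκ : 1 ≤ κ) (f : Equiv.Perm (Bits n)) (a : Bits n)
    {s m : ℕ} {t : QueryTree n} (ht : Within s m t)
    (k q : Bits n × Bits n → ZMod 2 → ℝ) (hkq : ∀ p, ChiBound κ (k p) (q p)) :
    (∑ G, mass k G * if a ∈ points f G t then 1 else 0) ^ 2 ≤
      κ ^ m * ∑ G, mass q G * if a ∈ points f G t then 1 else 0 := by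
  induction ht generalizing k q with
  | output s m o =>
    have hm : 1 ≤ κ ^ m := one_le_pow₀ hκ
    have hpt : ∀ G, (if a ∈ points f G (.output o) then (1 : ℝ) else 0) = if a = o then 1 else 0 :=
      fun G => by simp [points]
    simp only [hpt]
    rw [← Finset.sum_mul, ← Finset.sum_mul, sum_mass_eq_one fun p => (hkq p).sum_eq,
      sum_mass_eq_one fun p => (hkq p).sum_eq']
    split_ifs <;> simp [hm]
  | @queryF s m y next h ih =>
    by_cases hy : a = y
    · have hm : 1 ≤ κ ^ m := one_le_pow₀ hκ
      simp only [points, hy, Finset.mem_insert_self, if_true, mul_one,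
        sum_mass_eq_one fun p => (hkq p).sum_eq, sum_mass_eq_one fun p => (hkq p).sum_eq']
      simpa using hm
    · simp only [points, Finset.mem_insert, hy, false_or]
      exact ih (f y) k q hkq
  | @queryG s m p next h ih =>
    rw [sum_mass_mul_eq k p, sum_mass_mul_eq q p]
    have hcongr : ∀ (k' : Bits n × Bits n → ZMod 2 → ℝ) (v : ZMod 2),
        (∑ G, mass (Function.update k' p (Pi.single v 1)) G *
          if a ∈ points f G (.queryG p next) then 1 else 0) =
        ∑ G, mass (Function.update k' p (Pi.single v 1)) G *
          if a ∈ points f G (next v) then (1 : ℝ) else 0 := fun k' v =>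
      sum_mass_update_congr k' p v fun G hG => by simp only [points, hG]
    simp only [hcongr]
    -- Applied to the conditional means given the answer `v`; the induction hypothesis then bounds
    -- the square of each of them.
    refine ((hkq p).sq_le _).trans ?_
    rw [pow_succ', mul_assoc]
    refine mul_le_mul_of_nonneg_left ?_ (zero_le_one.trans hκ)
    rw [Finset.mul_sum]
    refine Finset.sum_le_sum fun v _ => ?_
    rw [mul_left_comm]
    refine mul_le_mul_of_nonneg_left (ih v _ _ fun p' => ?_) ((hkq p).nonneg v)
    -- The queried coordinate is now the same point mass under both laws, so the hypothesis on each
    -- coordinate persists even if it is queried again.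
    by_cases hp : p' = p
    · subst hp; simpa using ChiBound.single hκ v
    · simpa [hp] using hkq p'

end QueryTree


/-! ### Noisy predictors -/

variable {n : ℕ}

/-- The law of a random predictor with independent values: on rows in `B` the value is correct with
probability `1 / 2 + β`, all other values are uniform. -/
noncomputable def noisy (β : ℝ) (B : Finset (Bits n)) (f : Equiv.Perm (Bits n))
    (p : Bits n × Bits n) (v : ZMod 2) : ℝ :=
  coin (if p.1 ∈ B then β else 0) (f.symm p.1 ⬝ᵥ p.2) v

theorem noisy_nonneg {β : ℝ} (h0 : 0 ≤ β) (h1 : β ≤ 1 / 2) (B : Finset (Bits n))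
    (f : Equiv.Perm (Bits n)) (p : Bits n × Bits n) (v : ZMod 2) : 0 ≤ noisy β B f p v := by
  unfold noisy
  split_ifs
  · exact coin_nonneg h0 h1 _ _
  · exact coin_nonneg le_rfl (by norm_num) _ _

theorem sum_noisy (β : ℝ) (B : Finset (Bits n)) (f : Equiv.Perm (Bits n)) (p : Bits n × Bits n) :
    ∑ v, noisy β B f p v = 1 := sum_coin _ _

theorem chiBound_noisy {β : ℝ} (h0 : 0 ≤ β) (h1 : β ≤ 1 / 2) (B : Finset (Bits n)) (b : Bits n)
    (f : Equiv.Perm (Bits n)) (p : Bits n × Bits n) :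
    ChiBound (1 + 4 * β ^ 2) (noisy β B f p) (noisy β (B.erase b) f p) := by
  have hκ : 1 ≤ 1 + 4 * β ^ 2 := by nlinarith [sq_nonneg β]
  by_cases hp : p.1 ∈ B.erase b
  · have : noisy β (B.erase b) f p = noisy β B f p := by
      funext v; simp only [noisy, hp, Finset.mem_of_mem_erase hp]
    rw [this]
    exact .refl hκ (noisy_nonneg h0 h1 B f p) (sum_noisy β B f p)
  by_cases hp' : p.1 ∈ B
  · have e1 : noisy β B f p = coin β (f.symm p.1 ⬝ᵥ p.2) := by
      funext v; simp only [noisy, hp', if_true]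
    have e2 : noisy β (B.erase b) f p = coin 0 (f.symm p.1 ⬝ᵥ p.2) := by
      funext v; simp only [noisy, hp, if_false]
    rw [e1, e2]
    exact chiBound_coin _ _ _
  · have : noisy β (B.erase b) f p = noisy β B f p := by
      funext v; simp only [noisy, hp, hp']
    rw [this]
    exact .refl hκ (noisy_nonneg h0 h1 B f p) (sum_noisy β B f p)

/-- The correct values on the rows in `B`, and `0` elsewhere. -/
def signal (B : Finset (Bits n)) (f : Equiv.Perm (Bits n)) (p : Bits n × Bits n) : ZMod 2 :=
  if p.1 ∈ B then f.symm p.1 ⬝ᵥ p.2 else 0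

theorem coin_add (β : ℝ) (c c' v : ZMod 2) : coin β (c + c') (v + c') = coin β c v := by
  simp [coin]

/-- A noisy predictor is the signal plus noise whose law does not depend on `f`. -/
theorem sum_mass_noisy (β : ℝ) (B : Finset (Bits n)) (f : Equiv.Perm (Bits n))
    (F : (Bits n × Bits n → ZMod 2) → ℝ) :
    ∑ G, mass (noisy β B f) G * F G =
      ∑ ν : Bits n × Bits n → ZMod 2,
        mass (fun p => coin (if p.1 ∈ B then β else 0) 0) ν * F (ν + signal B f) := by
  rw [← Equiv.sum_comp (Equiv.addRight (signal B f))]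
  refine Finset.sum_congr rfl fun ν _ => ?_
  simp only [Equiv.coe_addRight]
  congr 1
  refine Finset.prod_congr rfl fun p _ => ?_
  simp only [noisy, signal, Pi.add_apply]
  split_ifs with hp
  · rw [← coin_add β 0 (f.symm p.1 ⬝ᵥ p.2), zero_add]
  · simp only [coin_zero]

/-- For each fixed noise `ν` the table is a function of `f`. As `b ∉ B`, an exchange of the
preimages of `b` and `f a₀` can alter it only in row `f a₀`, so the counting bound applies and is
averaged over `ν`. -/
theorem sum_sum_mass_mem_points_le {β : ℝ} (h0 : 0 ≤ β) (h1 : β ≤ 1 / 2) {B : Finset (Bits n)}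
    {b : Bits n} (hb : b ∉ B) {s m : ℕ} {t : QueryTree n} (ht : t.Within s m) :
    (∑ f : Equiv.Perm (Bits n), ∑ G, mass (noisy β B f) G *
        if f.symm b ∈ t.points f G then 1 else 0) * Fintype.card (Bits n) ≤
      2 * (s + 1 + m) * Fintype.card (Equiv.Perm (Bits n)) := by
  let W : (Bits n × Bits n → ZMod 2) → ℝ :=
    mass (fun p => coin (if p.1 ∈ B then β else 0) 0)
  have hW0 : ∀ ν, 0 ≤ W ν := mass_nonneg fun p v => by
    split_ifs
    · exact coin_nonneg h0 h1 _ _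
    · exact coin_nonneg le_rfl (by norm_num) _ _
  have hW1 : ∑ ν, W ν = 1 := sum_mass_eq_one fun p => sum_coin _ _
  simp_rw [sum_mass_noisy β B]
  rw [Finset.sum_comm, Finset.sum_mul]
  calc _ ≤ ∑ ν, W ν * (2 * (s + 1 + m) * Fintype.card (Equiv.Perm (Bits n))) := by
        refine Finset.sum_le_sum fun ν _ => ?_
        rw [← Finset.mul_sum, mul_assoc]
        refine mul_le_mul_of_nonneg_left ?_ (hW0 ν)
        rw [Finset.sum_boole]
        have := QueryTree.card_mem_points_le b (fun f => ν + signal B f) ?_ ht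
        · rw [mul_assoc]; exact_mod_cast this
        · intro f a₀ p hp
          simp only [Pi.add_apply, signal]
          split_ifs with hpB
          · have hpb : p.1 ≠ b := fun h => hb (h ▸ hpB)
            have : (f * Equiv.swap (f.symm b) a₀).symm p.1 = f.symm p.1 := by
              rw [Equiv.symm_apply_eq, Equiv.Perm.mul_apply, Equiv.swap_apply_of_ne_of_ne,
                Equiv.apply_symm_apply]
              · exact fun h => hpb (f.symm.injective h)
              · exact fun h => hp (by rw [← h, Equiv.apply_symm_apply])
            rw [this]
          · rfl
    _ = _ := by rw [← Finset.sum_mul, hW1, one_mul]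

/-! ### Noisy predictors predict: Chernoff and union bounds -/

theorem prod_ite_fst_eq {M : Type*} [CommMonoid M] {α β : Type*} [Fintype α] [Fintype β]
    [DecidableEq α] (z : α) (c : α × β → M) :
    ∏ p, (if p.1 = z then c p else 1) = ∏ x, c (z, x) := by
  rw [Fintype.prod_prod_type, Finset.prod_eq_single z]
  · simp
  · intro z' _ h; simp [h]
  · simp

theorem prob_eq {α : Type*} [Fintype α] (p : α → Prop) [DecidablePred p] :
    prob p = ((Finset.univ.filter p).card : ℝ) / Fintype.card α := by
  rw [prob, Nat.card_eq_fintype_card, Fintype.card_subtype]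

/-- With `X = ±1` of mean `4ε`, this bounds the mean of `exp(-2ε(X - 2ε))`. After dividing by
`exp(4ε²)`, the left side is `cosh 2ε - 4ε sinh 2ε ≤ exp(2ε²) - 8ε² ≤ 1 - 5ε²`. -/
theorem exp_mul_coin_le {ε : ℝ} (h0 : 0 ≤ ε) (h1 : ε ≤ 1 / 4) :
    (1 / 2 + 2 * ε) * Real.exp (-(2 * ε) * (1 - 2 * ε)) +
      (1 / 2 - 2 * ε) * Real.exp (-(2 * ε) * (-1 - 2 * ε)) ≤ Real.exp (-ε ^ 2) := by
  have e1 : Real.exp (-(2 * ε) * (1 - 2 * ε)) = Real.exp (4 * ε ^ 2) * Real.exp (-(2 * ε)) := by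
    rw [← Real.exp_add]; ring_nf
  have e2 : Real.exp (-(2 * ε) * (-1 - 2 * ε)) = Real.exp (4 * ε ^ 2) * Real.exp (2 * ε) := by
    rw [← Real.exp_add]; ring_nf
  have e3 : Real.exp (-ε ^ 2) = Real.exp (4 * ε ^ 2) * Real.exp (-(5 * ε ^ 2)) := by
    rw [← Real.exp_add]; ring_nf
  rw [e1, e2, e3]
  have hc : (Real.exp (2 * ε) + Real.exp (-(2 * ε))) / 2 ≤ Real.exp (2 * ε ^ 2) := by
    have := Real.cosh_le_exp_half_sq (2 * ε)
    rw [Real.cosh_eq] at this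
    refine this.trans_eq ?_
    ring_nf
  have hs : 2 * ε ≤ (Real.exp (2 * ε) - Real.exp (-(2 * ε))) / 2 := by
    have := Real.self_le_sinh_iff.2 (show 0 ≤ 2 * ε by linarith)
    rwa [Real.sinh_eq] at this
  have hu : Real.exp (2 * ε ^ 2) ≤ 1 + 2 * ε ^ 2 + (2 * ε ^ 2) ^ 2 := by
    have := Real.abs_exp_sub_one_sub_id_le (x := 2 * ε ^ 2)
      (by rw [abs_of_nonneg (by positivity)]; nlinarith)
    linarith [(abs_le.1 this).2]
  have hl := Real.add_one_le_exp (-(5 * ε ^ 2))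
  have hε : ε ^ 2 ≤ 1 / 16 := by nlinarith
  have key : (1 / 2 + 2 * ε) * Real.exp (-(2 * ε)) + (1 / 2 - 2 * ε) * Real.exp (2 * ε) ≤
      Real.exp (-(5 * ε ^ 2)) := by
    nlinarith [mul_le_mul_of_nonneg_left hs h0, sq_nonneg ε]
  calc _ = Real.exp (4 * ε ^ 2) *
        ((1 / 2 + 2 * ε) * Real.exp (-(2 * ε)) + (1 / 2 - 2 * ε) * Real.exp (2 * ε)) := by ring
    _ ≤ _ := mul_le_mul_of_nonneg_left key (Real.exp_pos _).le

open Classical in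
/-- Chernoff bound for one row of a noisy predictor. -/
theorem sum_mass_not_isGood_le {ε : ℝ} (h0 : 0 ≤ ε) (h1 : ε ≤ 1 / 4) {B : Finset (Bits n)}
    {f : Equiv.Perm (Bits n)} {y : Bits n} (hy : f y ∈ B) :
    (∑ G, mass (noisy (2 * ε) B f) G * if IsGood ε f G y then 0 else 1) ≤
      Real.exp (-ε ^ 2) ^ Fintype.card (Bits n) := by
  -- Exponential tilt: the row product of these factors is at least `1` whenever fewer than `(1/2 +
  -- ε)N` values are correct.
  let e : Bits n × Bits n → ZMod 2 → ℝ := fun p v =>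
    Real.exp (-(2 * ε) * ((if v = y ⬝ᵥ p.2 then 1 else -1) - 2 * ε))
  let r : Bits n × Bits n → ZMod 2 → ℝ := fun p v => if p.1 = f y then e p v else 1
  have hr : ∀ G : Bits n × Bits n → ZMod 2, (if IsGood ε f G y then (0 : ℝ) else 1) ≤
      ∏ p, r p (G p) := by
    intro G
    simp only [r]
    rw [prod_ite_fst_eq (f y) fun p => e p (G p)]
    split_ifs with hg
    · exact Finset.prod_nonneg fun x _ => (Real.exp_pos _).le
    · simp only [e]
      rw [← Real.exp_sum]
      refine Real.one_le_exp ?_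
      rw [IsGood, prob_eq, not_le, div_lt_iff₀ (by exact_mod_cast Fintype.card_pos)] at hg
      rw [← Finset.mul_sum, Finset.sum_sub_distrib]
      have : (∑ x : Bits n, if G (f y, x) = y ⬝ᵥ x then (1 : ℝ) else -1) =
          2 * ((Finset.univ.filter fun x : Bits n => G (tilde f (y, x)) = h (y, x)).card : ℝ) -
            Fintype.card (Bits n) := by
        have : ∀ x : Bits n, (if G (f y, x) = y ⬝ᵥ x then (1 : ℝ) else -1) =
            2 * (if G (tilde f (y, x)) = h (y, x) then 1 else 0) - 1 := by
          intro x
          change (if G (f y, x) = y ⬝ᵥ x then (1 : ℝ) else -1) =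
            2 * (if G (f y, x) = y ⬝ᵥ x then 1 else 0) - 1
          split_ifs <;> norm_num
        simp_rw [this]
        rw [Finset.sum_sub_distrib, ← Finset.mul_sum, Finset.sum_boole]
        simp
      rw [this]
      simp only [Finset.sum_const, Finset.card_univ, nsmul_eq_mul]
      nlinarith
  calc _ ≤ ∑ G, mass (noisy (2 * ε) B f) G * ∏ p, r p (G p) :=
        Finset.sum_le_sum fun G _ => mul_le_mul_of_nonneg_left (hr G)
          (mass_nonneg (noisy_nonneg (by linarith) (by linarith) B f) G)
    _ = ∑ G, mass (fun p v => noisy (2 * ε) B f p v * r p v) G := by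
        simp only [mass, Finset.prod_mul_distrib]
    _ = ∏ p, (if p.1 = f y then ∑ v, noisy (2 * ε) B f p v * e p v else 1) := by
        rw [sum_mass]
        refine Finset.prod_congr rfl fun p _ => ?_
        simp only [r]
        split_ifs
        · rfl
        · simpa using sum_noisy _ _ _ _
    _ = ∏ x, ∑ v, noisy (2 * ε) B f (f y, x) v * e (f y, x) v := prod_ite_fst_eq _ _
    _ ≤ ∏ _x : Bits n, Real.exp (-ε ^ 2) := by
        refine Finset.prod_le_prod (fun x _ => Finset.sum_nonneg fun v _ => mul_nonneg
          (noisy_nonneg (by linarith) (by linarith) _ _ _ _) (Real.exp_pos _).le) fun x _ => ?_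
        refine le_trans (le_of_eq ?_) (exp_mul_coin_le h0 h1)
        rw [sum_zmod_two (y ⬝ᵥ x)]
        simp only [noisy, hy, if_true, Equiv.symm_apply_apply, coin_self, coin_add_one, e]
        simp
    _ = _ := by simp

open Classical in
theorem sum_mass_not_isGood_eq_zero {ε : ℝ} (h1 : ε ≤ 1 / 2) {B : Finset (Bits n)}
    {f : Equiv.Perm (Bits n)} {y : Bits n} (hy : f y ∈ B) :
    (∑ G, mass (noisy (1 / 2) B f) G * if IsGood ε f G y then 0 else 1) = 0 := by
  refine Finset.sum_eq_zero fun G _ => ?_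
  split_ifs with hg
  · simp
  have : ∃ x : Bits n, G (f y, x) ≠ y ⬝ᵥ x := by
    by_contra! hall
    apply hg
    have : (Finset.univ.filter fun x : Bits n => G (tilde f (y, x)) = h (y, x)) = Finset.univ :=
      Finset.filter_true_of_mem fun x _ => hall x
    rw [IsGood, prob_eq, this, Finset.card_univ, div_self]
    · linarith
    · exact_mod_cast Fintype.card_ne_zero
  obtain ⟨x, hx⟩ := this
  rw [mul_one]
  refine Finset.prod_eq_zero (Finset.mem_univ (f y, x)) ?_
  simp [noisy, hy, coin, hx]

theorem predicts_of_isGood {δ ε : ℝ} {B : Finset (Bits n)}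
    (hB : δ * Fintype.card (Bits n) ≤ B.card) {f : Equiv.Perm (Bits n)}
    {G : Bits n × Bits n → ZMod 2} (hG : ∀ y, f y ∈ B → IsGood ε f G y) : Predicts δ ε f G := by
  classical
  rw [Predicts, prob_eq, le_div_iff₀ (by exact_mod_cast Fintype.card_pos)]
  refine hB.trans ?_
  have : B.image f.symm ⊆ Finset.univ.filter fun y => IsGood ε f G y := by
    intro y hy
    obtain ⟨z, hz, rfl⟩ := Finset.mem_image.1 hy
    simpa using hG (f.symm z) (by simpa using hz)
  have := Finset.card_le_card this
  rw [Finset.card_image_of_injective _ f.symm.injective] at this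
  exact_mod_cast this

open Classical in
/-- Union bound: a noisy predictor usually predicts. -/
theorem one_sub_le_sum_mass_predicts {δ ε β η : ℝ} (h0 : 0 ≤ β) (h1 : β ≤ 1 / 2)
    {B : Finset (Bits n)} (hB : δ * Fintype.card (Bits n) ≤ B.card) {f : Equiv.Perm (Bits n)}
    (hη : 0 ≤ η) (hrow : ∀ y, f y ∈ B →
      (∑ G, mass (noisy β B f) G * if IsGood ε f G y then 0 else 1) ≤ η) :
    1 - Fintype.card (Bits n) * η ≤
      ∑ G, mass (noisy β B f) G * if Predicts δ ε f G then 1 else 0 := by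
  have hm := mass_nonneg (noisy_nonneg h0 h1 B f)
  have hpt : ∀ G, 1 ≤ (if Predicts δ ε f G then (1 : ℝ) else 0) +
      ∑ y ∈ Finset.univ.filter (fun y => f y ∈ B), if IsGood ε f G y then (0 : ℝ) else 1 := by
    intro G
    by_cases hP : Predicts δ ε f G
    · rw [if_pos hP, le_add_iff_nonneg_right]
      exact Finset.sum_nonneg fun y _ => by split_ifs <;> norm_num
    · have : ∃ y, f y ∈ B ∧ ¬ IsGood ε f G y := by
        by_contra! hall
        exact hP (predicts_of_isGood hB hall)
      obtain ⟨y, hy, hg⟩ := this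
      rw [if_neg hP, zero_add]
      refine le_trans (by rw [if_neg hg]) (Finset.single_le_sum
        (f := fun y => if IsGood ε f G y then (0 : ℝ) else 1)
        (fun y _ => by split_ifs <;> norm_num)
        (Finset.mem_filter.2 ⟨Finset.mem_univ y, hy⟩))
  have hsum : 1 ≤ ∑ G, mass (noisy β B f) G * ((if Predicts δ ε f G then (1 : ℝ) else 0) +
      ∑ y ∈ Finset.univ.filter (fun y => f y ∈ B), if IsGood ε f G y then (0 : ℝ) else 1) := by
    refine (sum_mass_eq_one (sum_noisy β B f)).symm.trans_le (Finset.sum_le_sum fun G _ => ?_)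
    exact le_mul_of_one_le_right (hm G) (hpt G)
  simp_rw [mul_add, Finset.sum_add_distrib, Finset.mul_sum] at hsum
  rw [Finset.sum_comm (s := Finset.univ) (t := Finset.univ.filter _)] at hsum
  have hle : ∑ y ∈ Finset.univ.filter (fun y => f y ∈ B),
      ∑ G, (mass (noisy β B f) G * if IsGood ε f G y then (0 : ℝ) else 1) ≤
        Fintype.card (Bits n) * η := by
    refine (Finset.sum_le_card_nsmul _ _ η fun y hy => hrow y (Finset.mem_filter.1 hy).2).trans ?_
    rw [nsmul_eq_mul]
    refine mul_le_mul_of_nonneg_right ?_ hη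
    exact_mod_cast Finset.card_le_univ _
  linarith

/-! ### Averages over the coins of the algorithm -/

section coins

variable {α : Type*} (A : PMF α)

theorem hasSum_toReal : HasSum (fun D => (A D).toReal) 1 := by
  have := ENNReal.hasSum_toReal (f := fun D => A D) (by rw [A.tsum_coe]; exact ENNReal.one_ne_top)
  rwa [← ENNReal.tsum_toReal_eq fun D => A.apply_ne_top D, A.tsum_coe, ENNReal.toReal_one] at this

theorem summable_toReal_mul {c : α → ℝ} (h0 : ∀ D, 0 ≤ c D) (h1 : ∀ D, c D ≤ 1) :
    Summable fun D => (A D).toReal * c D :=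
  (hasSum_toReal A).summable.of_nonneg_of_le (fun D => mul_nonneg ENNReal.toReal_nonneg (h0 D))
    fun D => mul_le_of_le_one_right ENNReal.toReal_nonneg (h1 D)

theorem sum_mul_tsum_toReal {ι : Type*} (s : Finset ι) (w : ι → ℝ) {c : ι → α → ℝ}
    (h0 : ∀ i D, 0 ≤ c i D) (h1 : ∀ i D, c i D ≤ 1) :
    ∑ i ∈ s, w i * ∑' D, (A D).toReal * c i D =
      ∑' D, (A D).toReal * ∑ i ∈ s, w i * c i D := by
  simp_rw [← tsum_mul_left, Finset.mul_sum]
  rw [Summable.tsum_finsetSum]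
  · refine Finset.sum_congr rfl fun i _ => tsum_congr fun D => by ring
  · intro i _
    refine ((summable_toReal_mul A (h0 i) (h1 i)).mul_left (w i)).congr fun D => by ring

theorem summable_toReal_mul_sum {ι : Type*} (s : Finset ι) (w : ι → ℝ) {c : ι → α → ℝ}
    (h0 : ∀ i D, 0 ≤ c i D) (h1 : ∀ i D, c i D ≤ 1) :
    Summable fun D => (A D).toReal * ∑ i ∈ s, w i * c i D := by
  simp_rw [Finset.mul_sum]
  refine summable_sum fun i _ => ?_
  refine ((summable_toReal_mul A (h0 i) (h1 i)).mul_left (w i)).congr fun D => by ring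

theorem tsum_toReal_mul_le {c : α → ℝ} {C : ℝ} (hs : Summable fun D => (A D).toReal * c D)
    (hc : ∀ D ∈ A.support, c D ≤ C) : ∑' D, (A D).toReal * c D ≤ C := by
  have h := (hasSum_toReal A).mul_right C
  rw [one_mul] at h
  rw [← h.tsum_eq]
  refine hs.tsum_le_tsum (fun D => ?_) h.summable
  by_cases hD : D ∈ A.support
  · exact mul_le_mul_of_nonneg_left (hc D hD) ENNReal.toReal_nonneg
  · rw [PMF.mem_support_iff, not_not] at hD
    simp [hD]

end coins

/-! ### Success probability against noisy predictors -/

theorem prob_nonneg {α : Type*} [Fintype α] (p : α → Prop) : 0 ≤ prob p := by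
  unfold prob; positivity

theorem prob_le_one {α : Type*} [Fintype α] (p : α → Prop) : prob p ≤ 1 := by
  classical
  rw [prob_eq]
  exact div_le_one_of_le₀ (by exact_mod_cast Finset.card_le_univ _) (by positivity)

theorem prob_prod {α β : Type*} [Fintype α] [Fintype β] (p : α × β → Prop) :
    prob p = ∑ a, (Fintype.card α : ℝ)⁻¹ * prob fun b => p (a, b) := by
  classical
  simp_rw [prob_eq, div_eq_mul_inv]
  rw [← Finset.sum_boole, Fintype.sum_prod_type, Fintype.card_prod, Nat.cast_mul, Finset.sum_mul]
  refine Finset.sum_congr rfl fun a _ => ?_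
  rw [← Finset.sum_boole, mul_inv]
  ring

/-- A weighted mean is at least one of the values that carry weight. -/
theorem exists_mul_sum_le {α : Type*} [Fintype α] {w : α → ℝ} (hw : ∀ a, 0 ≤ w a)
    (hpos : 0 < ∑ a, w a) (σ : α → ℝ) : ∃ a, 0 < w a ∧ σ a * ∑ a, w a ≤ ∑ a, w a * σ a := by
  by_contra! hlt
  obtain ⟨a₀, -, ha₀⟩ := Finset.exists_lt_of_sum_lt
    (show ∑ _a : α, (0 : ℝ) < ∑ a, w a by simpa using hpos)
  have : ∑ a, w a * ∑ a', w a' * σ a' < ∑ a, w a * (σ a * ∑ a', w a') := by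
    refine Finset.sum_lt_sum (fun a _ => ?_)
      ⟨a₀, Finset.mem_univ _, mul_lt_mul_of_pos_left (hlt a₀ ha₀) ha₀⟩
    rcases (hw a).eq_or_lt with h | h
    · simp [← h]
    · exact (mul_lt_mul_of_pos_left (hlt a h) h).le
  simp_rw [← mul_assoc] at this
  rw [← Finset.sum_mul, ← Finset.sum_mul, mul_comm] at this
  exact lt_irrefl _ this

/-- The change of measure to `B.erase b` is made for each `f` separately; Cauchy–Schwarz over `f`
turns the bounds on squares into a bound on the sum. -/
theorem sum_sum_mass_mem_points_le_of_sq_le {β : ℝ} (h0 : 0 ≤ β) (h1 : β ≤ 1 / 2)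
    (B : Finset (Bits n)) (b : Bits n) {s m : ℕ} {t : QueryTree n} (ht : t.Within s m) {γ : ℝ}
    (hγ : 0 ≤ γ)
    (h : (1 + 4 * β ^ 2) ^ m * (2 * (s + 1 + m) / Fintype.card (Bits n)) ≤ γ ^ 2) :
    (∑ f : Equiv.Perm (Bits n), ∑ G, mass (noisy β B f) G *
        if f.symm b ∈ t.points f G then 1 else 0) ≤
      γ * Fintype.card (Equiv.Perm (Bits n)) := by
  have hN : (0 : ℝ) < Fintype.card (Bits n) := by exact_mod_cast Fintype.card_pos
  refine abs_le_of_sq_le_sq' ?_ (by positivity) |>.2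
  refine (sq_sum_le_card_mul_sum_sq).trans ?_
  rw [Finset.card_univ]
  have hκ : 1 ≤ 1 + 4 * β ^ 2 := by nlinarith [sq_nonneg β]
  have hQ := sum_sum_mass_mem_points_le h0 h1 (Finset.notMem_erase b B) ht
  rw [← le_div_iff₀ hN] at hQ
  have := Finset.sum_le_sum fun (f : Equiv.Perm (Bits n)) (_ : f ∈ Finset.univ) =>
    QueryTree.sq_sum_mass_mem_points_le hκ f (f.symm b) ht _ _ (chiBound_noisy h0 h1 B b f)
  rw [← Finset.mul_sum] at this
  have hP : (0 : ℝ) ≤ Fintype.card (Equiv.Perm (Bits n)) := by positivity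
  calc _ ≤ (Fintype.card (Equiv.Perm (Bits n)) : ℝ) * ((1 + 4 * β ^ 2) ^ m *
        (2 * (s + 1 + m) * Fintype.card (Equiv.Perm (Bits n)) / Fintype.card (Bits n))) :=
        mul_le_mul_of_nonneg_left
          (this.trans (mul_le_mul_of_nonneg_left hQ (by positivity))) hP
    _ = ((1 + 4 * β ^ 2) ^ m * (2 * (s + 1 + m) / Fintype.card (Bits n))) *
        (Fintype.card (Equiv.Perm (Bits n)) : ℝ) ^ 2 := by ring
    _ ≤ γ ^ 2 * (Fintype.card (Equiv.Perm (Bits n)) : ℝ) ^ 2 :=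
        mul_le_mul_of_nonneg_right h (sq_nonneg _)
    _ = _ := by ring

open Classical in
/-- The success of a deterministic algorithm against a noisy predictor, on the event that it
predicts. -/
theorem sum_sum_mass_prob_le {δ ε β γ ρ : ℝ} (h0 : 0 ≤ β) (h1 : β ≤ 1 / 2) (hγ : 0 ≤ γ)
    (B : Finset (Bits n)) (D : DetAlg n) {TF TG : ℕ}
    (hD : ∀ (f : Equiv.Perm (Bits n)) (G : Bits n × Bits n → ZMod 2) (a : Bits n),
      Predicts δ ε f G → (D (f a)).numF f G ≤ TF ∧ (D (f a)).numG f G ≤ TG)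
    (hρ : 2 * (TF + 1 + TG) / Fintype.card (Bits n) ≤ ρ)
    (hρ' : (1 + 4 * β ^ 2) ^ TG * ρ ≤ γ ^ 2) :
    (∑ f : Equiv.Perm (Bits n), ∑ G, (mass (noisy β B f) G * if Predicts δ ε f G then 1 else 0) *
        prob fun a => (D (f a)).run f G = a) ≤
      (ρ + γ * (B.card / Fintype.card (Bits n))) * Fintype.card (Equiv.Perm (Bits n)) := by
  have hN : (0 : ℝ) < Fintype.card (Bits n) := by exact_mod_cast Fintype.card_pos
  have hP : (0 : ℝ) ≤ Fintype.card (Equiv.Perm (Bits n)) := by positivity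
  have hm := fun f => mass_nonneg (noisy_nonneg h0 h1 B f)
  have hb : ∀ b : Bits n, (∑ f : Equiv.Perm (Bits n), ∑ G, mass (noisy β B f) G *
        if f.symm b ∈ ((D b).trunc TF TG).points f G then 1 else 0) ≤
      (ρ + if b ∈ B then γ else 0) * Fintype.card (Equiv.Perm (Bits n)) := by
    intro b
    have ht := (D b).within_trunc TF TG
    have hρ0 : 0 ≤ ρ := le_trans (by positivity) hρ
    split_ifs with hbB
    · refine (sum_sum_mass_mem_points_le_of_sq_le h0 h1 B b ht hγ
        (le_trans (mul_le_mul_of_nonneg_left hρ (by positivity)) hρ')).trans ?_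
      exact mul_le_mul_of_nonneg_right (by linarith) hP
    · have := sum_sum_mass_mem_points_le h0 h1 hbB ht
      rw [← le_div_iff₀ hN] at this
      refine this.trans ?_
      rw [add_zero, mul_div_right_comm]
      exact mul_le_mul_of_nonneg_right hρ hP
  have hpt : ∀ (f : Equiv.Perm (Bits n)) (G : Bits n × Bits n → ZMod 2),
      (mass (noisy β B f) G * if Predicts δ ε f G then 1 else 0) *
        (prob fun a => (D (f a)).run f G = a) ≤ (Fintype.card (Bits n) : ℝ)⁻¹ *
      ∑ b, mass (noisy β B f) G * if f.symm b ∈ ((D b).trunc TF TG).points f G then 1 else 0 := by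
    intro f G
    rw [← Finset.mul_sum, mul_left_comm, mul_assoc]
    refine mul_le_mul_of_nonneg_left ?_ (hm f G)
    split_ifs with hPr
    -- A uniform `a` is re-indexed by `b = f a`. The output counts as a touched point, so success
    -- implies that the preimage of `b` is touched.
    · rw [one_mul, prob_eq, div_eq_inv_mul, ← Equiv.sum_comp f, ← Finset.sum_boole]
      refine mul_le_mul_of_nonneg_left (Finset.sum_le_sum fun a _ => ?_) (by positivity)
      rw [Equiv.symm_apply_apply]
      by_cases hr : (D (f a)).run f G = a
      · have hmem := ((D (f a)).trunc TF TG).run_mem_points f G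
        rw [QueryTree.run_trunc f G _ TF TG (hD f G a hPr).1 (hD f G a hPr).2, hr] at hmem
        rw [if_pos hmem, if_pos hr]
      · rw [if_neg hr]; split_ifs <;> norm_num
    · rw [zero_mul]
      exact mul_nonneg (by positivity) (Finset.sum_nonneg fun b _ => by split_ifs <;> norm_num)
  calc _ ≤ ∑ f : Equiv.Perm (Bits n), ∑ G, (Fintype.card (Bits n) : ℝ)⁻¹ *
      ∑ b, mass (noisy β B f) G * if f.symm b ∈ ((D b).trunc TF TG).points f G then 1 else 0 :=
        Finset.sum_le_sum fun f _ => Finset.sum_le_sum fun G _ => hpt f G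
    _ = (Fintype.card (Bits n) : ℝ)⁻¹ * ∑ b, ∑ f : Equiv.Perm (Bits n), ∑ G,
      mass (noisy β B f) G * if f.symm b ∈ ((D b).trunc TF TG).points f G then 1 else 0 := by
        rw [Finset.sum_comm (s := (Finset.univ : Finset (Bits n))), Finset.mul_sum]
        refine Finset.sum_congr rfl fun f _ => ?_
        rw [Finset.sum_comm (s := (Finset.univ : Finset (Bits n))), Finset.mul_sum]
    _ ≤ (Fintype.card (Bits n) : ℝ)⁻¹ * ∑ b : Bits n,
      (ρ + if b ∈ B then γ else 0) * Fintype.card (Equiv.Perm (Bits n)) :=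
        mul_le_mul_of_nonneg_left (Finset.sum_le_sum fun b _ => hb b) (by positivity)
    _ = _ := by
        rw [← Finset.sum_mul, Finset.sum_add_distrib]
        simp only [Finset.sum_const, Finset.card_univ, nsmul_eq_mul, Finset.sum_ite_mem,
          Finset.univ_inter]
        field_simp

open Classical in
/-- If noisy predictors predict with probability at least `1 / 2`, some predictors keep the
success probability small. -/
theorem exists_predicts_successProb_le {δ ε β γ ρ : ℝ} (h0 : 0 ≤ β) (h1 : β ≤ 1 / 2) (hγ : 0 ≤ γ)
    (B : Finset (Bits n)) (A : RandAlg n) {TF TG : ℕ} (hA : QueryBound δ ε A TF TG)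
    (hρ : 2 * (TF + 1 + TG) / Fintype.card (Bits n) ≤ ρ)
    (hρ' : (1 + 4 * β ^ 2) ^ TG * ρ ≤ γ ^ 2)
    (hpred : ∀ f : Equiv.Perm (Bits n),
      1 / 2 ≤ ∑ G, mass (noisy β B f) G * if Predicts δ ε f G then 1 else 0) :
    ∃ G : Equiv.Perm (Bits n) → Bits n × Bits n → ZMod 2, (∀ f, Predicts δ ε f (G f)) ∧
      successProb A G ≤ 2 * (ρ + γ * (B.card / Fintype.card (Bits n))) := by
  let w : Equiv.Perm (Bits n) → (Bits n × Bits n → ZMod 2) → ℝ := fun f G =>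
    mass (noisy β B f) G * if Predicts δ ε f G then 1 else 0
  let c : Equiv.Perm (Bits n) → (Bits n × Bits n → ZMod 2) → DetAlg n → ℝ := fun f G D =>
    prob fun a => (D (f a)).run f G = a
  let σ : Equiv.Perm (Bits n) → (Bits n × Bits n → ZMod 2) → ℝ := fun f G =>
    ∑' D, (A D).toReal * c f G D
  have hc0 : ∀ f G D, 0 ≤ c f G D := fun f G D => prob_nonneg _
  have hc1 : ∀ f G D, c f G D ≤ 1 := fun f G D => prob_le_one _
  have hσ0 : ∀ f G, 0 ≤ σ f G := fun f G =>
    tsum_nonneg fun D => mul_nonneg ENNReal.toReal_nonneg (hc0 f G D)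
  have hw : ∀ f G, 0 ≤ w f G := fun f G =>
    mul_nonneg (mass_nonneg (noisy_nonneg h0 h1 B f) G) (by split_ifs <;> norm_num)
  -- The table is chosen separately for each `f`, with positive weight (hence predicting) and
  -- success at most the conditional average.
  choose G hG0 hG using fun f => exists_mul_sum_le (hw f)
    (lt_of_lt_of_le (by norm_num) (hpred f)) (σ f)
  refine ⟨G, fun f => ?_, ?_⟩
  · by_contra hf
    have := hG0 f
    simp [w, hf] at this
  have hσ : ∀ f, σ f (G f) ≤ 2 * ∑ G', w f G' * σ f G' := fun f => by
    have h2 : 1 / 2 ≤ ∑ G', w f G' := hpred f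
    nlinarith [hG f, mul_le_mul_of_nonneg_left h2 (hσ0 f (G f))]
  have hP : (0 : ℝ) < Fintype.card (Equiv.Perm (Bits n)) := by exact_mod_cast Fintype.card_pos
  have hdet : ∀ D ∈ A.support,
      ∑ q : Equiv.Perm (Bits n) × (Bits n × Bits n → ZMod 2), w q.1 q.2 * c q.1 q.2 D ≤
        (ρ + γ * (B.card / Fintype.card (Bits n))) * Fintype.card (Equiv.Perm (Bits n)) := by
    intro D hD
    rw [Fintype.sum_prod_type]
    exact sum_sum_mass_prob_le h0 h1 hγ B D (hA D hD) hρ hρ'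
  have htot : ∑ f, ∑ G', w f G' * σ f G' ≤
      (ρ + γ * (B.card / Fintype.card (Bits n))) * Fintype.card (Equiv.Perm (Bits n)) := by
    have := sum_mul_tsum_toReal A Finset.univ
      (fun q : Equiv.Perm (Bits n) × (Bits n × Bits n → ZMod 2) => w q.1 q.2)
      (c := fun q => c q.1 q.2) (fun q => hc0 q.1 q.2) (fun q => hc1 q.1 q.2)
    rw [Fintype.sum_prod_type] at this
    refine this.trans_le (tsum_toReal_mul_le A ?_ hdet)
    exact summable_toReal_mul_sum A _ _ (fun q => hc0 q.1 q.2) (fun q => hc1 q.1 q.2)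
  calc successProb A G = ∑ f, (Fintype.card (Equiv.Perm (Bits n)) : ℝ)⁻¹ * σ f (G f) := by
        rw [sum_mul_tsum_toReal A Finset.univ _ (c := fun f => c f (G f))
          (fun f => hc0 f (G f)) (fun f => hc1 f (G f))]
        simp only [successProb, prob_prod, c]
    _ ≤ ∑ f, (Fintype.card (Equiv.Perm (Bits n)) : ℝ)⁻¹ * (2 * ∑ G', w f G' * σ f G') :=
        Finset.sum_le_sum fun f _ => mul_le_mul_of_nonneg_left (hσ f) (by positivity)
    _ = (Fintype.card (Equiv.Perm (Bits n)) : ℝ)⁻¹ * 2 * ∑ f, ∑ G', w f G' * σ f G' := by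
        rw [← Finset.mul_sum, ← Finset.mul_sum, mul_assoc]
    _ ≤ (Fintype.card (Equiv.Perm (Bits n)) : ℝ)⁻¹ * 2 *
        ((ρ + γ * (B.card / Fintype.card (Bits n))) * Fintype.card (Equiv.Perm (Bits n))) :=
        mul_le_mul_of_nonneg_left htot (by positivity)
    _ = _ := by field_simp


/-! ### Choice of parameters and numerical estimates -/

theorem card_bits (n : ℕ) : Fintype.card (Bits n) = 2 ^ n := by
  simp [ZMod.card]

open Classical in
/-- For every `ε ≤ 1 / 2` there is a bias `β ≤ 2 ε` for which noisy predictors usually predict. -/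
theorem exists_bias_predicts {n : ℕ} {δ ε : ℝ} (h0 : 0 ≤ ε) (h1 : ε ≤ 1 / 2) {B : Finset (Bits n)}
    (hB : δ * Fintype.card (Bits n) ≤ B.card)
    (hε : Fintype.card (Bits n) * Real.exp (-ε ^ 2) ^ Fintype.card (Bits n) ≤ 1 / 2) :
    ∃ β : ℝ, 0 ≤ β ∧ β ≤ 1 / 2 ∧ β ≤ 2 * ε ∧ ∀ f : Equiv.Perm (Bits n),
      1 / 2 ≤ ∑ G, mass (noisy β B f) G * if Predicts δ ε f G then 1 else 0 := by
  -- For `ε > 1/4` the bias `2ε` would exceed `1/2`; the rows in `B` are then made exactly correct.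
  rcases le_or_gt ε (1 / 4) with h | h
  · refine ⟨2 * ε, by linarith, by linarith, le_rfl, fun f => ?_⟩
    have := one_sub_le_sum_mass_predicts (ε := ε) (by linarith) (by linarith) hB (f := f)
      (pow_nonneg (Real.exp_pos _).le _) fun y hy => sum_mass_not_isGood_le h0 h hy
    linarith
  · refine ⟨1 / 2, by norm_num, le_rfl, by linarith, fun f => ?_⟩
    have := one_sub_le_sum_mass_predicts (ε := ε) (by norm_num) le_rfl hB (f := f)
      le_rfl fun y hy => (sum_mass_not_isGood_eq_zero h1 hy).le
    linarith

/-- The exponent is `ε²M² ≥ nM ≥ 45n`, which overwhelms the union bound over `2^n` rows. -/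
theorem two_pow_mul_exp_pow_le {n : ℕ} (hn : 11 ≤ n) {ε M : ℝ} (hM : M ^ 2 = 2 ^ n) (hM45 : 45 ≤ M)
    (hε : n ≤ ε ^ 2 * M) : (2 : ℝ) ^ n * Real.exp (-ε ^ 2) ^ (2 ^ n) ≤ 1 / 2 := by
  have hn' : (11 : ℝ) ≤ n := by exact_mod_cast hn
  have h2 : (2 : ℝ) ^ n ≤ Real.exp n := by
    rw [← Real.exp_one_pow]
    exact pow_le_pow_left₀ (by norm_num) (by linarith [Real.add_one_le_exp (1 : ℝ)]) n
  have h3 : Real.exp (-ε ^ 2) ^ (2 ^ n) ≤ Real.exp (-(n * 45)) := by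
    rw [← Real.exp_nat_mul]
    refine Real.exp_le_exp.2 ?_
    push_cast
    rw [← hM]
    nlinarith [mul_le_mul_of_nonneg_right hε (show 0 ≤ M by linarith)]
  calc _ ≤ Real.exp n * Real.exp (-(n * 45)) :=
        mul_le_mul h2 h3 (by positivity) (Real.exp_pos _).le
    _ = Real.exp (-(n * 44)) := by rw [← Real.exp_add]; ring_nf
    _ ≤ Real.exp (-1) := Real.exp_le_exp.2 (by linarith)
    _ ≤ 1 / 2 := by
        rw [Real.exp_neg, one_div]
        exact inv_anti₀ (by norm_num) (by linarith [Real.add_one_le_exp (1 : ℝ)])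

/-- Since `β ≤ 2ε`, the power is at most `exp(16 ε² TG) ≤ exp(16n/1000)`, a small power of `M`. -/
theorem pow_mul_le {n TG : ℕ} (hn : 11 ≤ n) {β ε M : ℝ} (hM0 : 0 < M) (h0 : 0 ≤ β)
    (hβ : β ≤ 2 * ε) (hexp : Real.exp (n / 4) ≤ M) (hTG : ε ^ 2 * TG ≤ n / 1000) :
    (1 + 4 * β ^ 2) ^ TG * (1 / 20 / M) ≤ (1 / 10) ^ 2 := by
  have hn' : (11 : ℝ) ≤ n := by exact_mod_cast hn
  have h1 : (1 + 4 * β ^ 2) ^ TG ≤ Real.exp (16 * n / 1000) := by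
    have : 1 + 4 * β ^ 2 ≤ Real.exp (16 * ε ^ 2) := by
      nlinarith [Real.add_one_le_exp (16 * ε ^ 2)]
    refine (pow_le_pow_left₀ (by positivity) this TG).trans ?_
    rw [← Real.exp_nat_mul]
    exact Real.exp_le_exp.2 (by linarith)
  have h2 : 5 * Real.exp (16 * n / 1000) ≤ Real.exp (n / 4) := by
    have h5 : 5 ≤ Real.exp 2 := by
      rw [show (2 : ℝ) = 1 + 1 by norm_num, Real.exp_add]
      nlinarith [Real.exp_one_gt_d9]
    calc _ ≤ Real.exp 2 * Real.exp (16 * n / 1000) :=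
          mul_le_mul_of_nonneg_right h5 (Real.exp_pos _).le
      _ ≤ _ := by rw [← Real.exp_add]; exact Real.exp_le_exp.2 (by linarith)
  rw [mul_div_assoc', div_le_iff₀ hM0]
  linarith

theorem eleven_le_of_four_mul_le {n : ℕ} (hn : n ≠ 0) {M : ℝ} (hM : M ^ 2 = 2 ^ n)
    (h : 4 * n ≤ M) : 11 ≤ n := by
  have h1 : ((4 * n) ^ 2 : ℝ) ≤ 2 ^ n := hM ▸ pow_le_pow_left₀ (by positivity) h 2
  have h2 : (4 * n) ^ 2 ≤ 2 ^ n := by exact_mod_cast h1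
  by_contra! hlt
  interval_cases n <;> simp_all

theorem query_lower_bound (n : ℕ) (δ ε : ℝ) (hδ : (2 : ℝ) ^ (-(n : ℝ) / 2) ≤ δ) (hδ1 : δ ≤ 1)
    (hε : Real.sqrt (n : ℝ) * (2 : ℝ) ^ (-(n : ℝ) / 4) ≤ ε) (hε1 : ε ≤ 1 / 2)
    (A : RandAlg n) (TF TG : ℕ) (hS : Solves δ ε A) (hQ : QueryBound δ ε A TF TG) :
    1 / 1000 * (2 : ℝ) ^ ((n : ℝ) / 2) ≤ TF ∨ 1 / 1000 * ((n : ℝ) / ε ^ 2) ≤ TG := by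
  rcases eq_or_ne n 0 with rfl | hn0
  · right; simp
  by_contra! hlt
  obtain ⟨hTF, hTG⟩ := hlt
  set M : ℝ := (2 : ℝ) ^ ((n : ℝ) / 2) with hMdef
  have hM0 : 0 < M := by positivity
  have hM : M ^ 2 = 2 ^ n := by
    rw [hMdef, ← Real.rpow_natCast, ← Real.rpow_mul (by norm_num), ← Real.rpow_natCast]
    norm_num
  have hδM : 1 ≤ δ * M := by
    have : (2 : ℝ) ^ (-(n : ℝ) / 2) * M = 1 := by
      rw [hMdef, ← Real.rpow_add (by norm_num)]
      ring_nf; simp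
    exact this ▸ mul_le_mul_of_nonneg_right hδ hM0.le
  have hn1 : (1 : ℝ) ≤ n := by exact_mod_cast Nat.one_le_iff_ne_zero.2 hn0
  have hε0 : 0 < ε := lt_of_lt_of_le (by positivity) hε
  have hεM : n ≤ ε ^ 2 * M := by
    have h1 := pow_le_pow_left₀ (by positivity) hε 2
    have h2 : ((2 : ℝ) ^ (-(n : ℝ) / 4)) ^ 2 * M = 1 := by
      rw [hMdef, ← Real.rpow_natCast, ← Real.rpow_mul (by norm_num),
        ← Real.rpow_add (by norm_num)]
      push_cast; ring_nf; simp
    rw [mul_pow, Real.sq_sqrt (by positivity)] at h1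
    calc (n : ℝ) = n * ((2 : ℝ) ^ (-(n : ℝ) / 4)) ^ 2 * M := by rw [mul_assoc, h2, mul_one]
      _ ≤ _ := mul_le_mul_of_nonneg_right h1 hM0.le
  -- The hypotheses on `ε` exclude small `n`: `n ≤ ε²M ≤ M/4`.
  have hn : 11 ≤ n := eleven_le_of_four_mul_le hn0 hM (by
    nlinarith [mul_le_mul_of_nonneg_right (show ε ^ 2 ≤ 1 / 4 by nlinarith) hM0.le])
  have hM45 : 45 ≤ M := by
    have : (2 : ℝ) ^ 11 ≤ 2 ^ n := pow_le_pow_right₀ (by norm_num) hn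
    refine le_of_sq_le_sq ?_ hM0.le
    rw [hM]; linarith
  have hexp : Real.exp (n / 4) ≤ M := by
    rw [hMdef, Real.rpow_def_of_pos (by norm_num)]
    refine Real.exp_le_exp.2 ?_
    nlinarith [Real.log_two_gt_d9]
  have hTGε : ε ^ 2 * TG ≤ n / 1000 := by
    have := mul_le_mul_of_nonneg_left hTG.le (sq_nonneg ε)
    refine this.trans_eq ?_
    field_simp
  have hTGM : (TG : ℝ) ≤ M / 1000 := by
    refine hTG.le.trans ?_
    have : (n : ℝ) / ε ^ 2 ≤ M := by rw [div_le_iff₀ (by positivity)]; linarith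
    linarith
  have hN : (Fintype.card (Bits n) : ℝ) = M ^ 2 := by rw [hM, card_bits]; push_cast; rfl
  have hδ0 : 0 ≤ δ := le_trans (by positivity) hδ
  obtain ⟨B, -, hBcard⟩ := Finset.exists_subset_card_eq
    (s := (Finset.univ : Finset (Bits n))) (n := ⌈δ * Fintype.card (Bits n)⌉₊) (by
      rw [Finset.card_univ, Nat.ceil_le]
      exact mul_le_of_le_one_left (by positivity) hδ1)
  have hB : δ * Fintype.card (Bits n) ≤ B.card := hBcard ▸ Nat.le_ceil _
  have hB' : (B.card : ℝ) ≤ δ * M ^ 2 + 1 := by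
    rw [hBcard, hN]; exact (Nat.ceil_lt_add_one (by positivity)).le
  obtain ⟨β, hβ0, hβ1, hβε, hpred⟩ := exists_bias_predicts hε0.le hε1 hB (by
    rw [card_bits]
    exact_mod_cast two_pow_mul_exp_pow_le hn hM hM45 hεM)
  -- The bound for `ρ` amounts to `2(TF + 1 + TG) ≤ M/20`, where `TF` and `TG` are at most `M/1000`
  -- and `M ≥ 45` absorbs the `1`.
  obtain ⟨G, hG, hGle⟩ := exists_predicts_successProb_le (γ := 1 / 10) (ρ := 1 / 20 / M)
    hβ0 hβ1 (by norm_num) B A hQ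
    (by
      rw [hN, div_div, div_le_div_iff₀ (by positivity) (by positivity)]
      nlinarith)
    (pow_mul_le hn hM0 hβ0 hβε hexp hTGε) hpred
  have hle := (hS G hG).trans hGle
  have h1 : 1 / 20 / M ≤ δ / 20 := by
    rw [div_le_iff₀ hM0]; linarith
  have h2 : (B.card : ℝ) / Fintype.card (Bits n) ≤ δ + δ / 45 := by
    rw [hN, div_le_iff₀ (by positivity)]
    nlinarith [mul_le_mul hδM hM45 (by norm_num) (by positivity)]
  have hδpos : 0 < δ := lt_of_lt_of_le (by positivity) hδ
  -- Success is at most `2(δ/20 + (1/10)(46/45)δ) < δ/2`.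
  linarith

end GLStar

theorem theorem5 :
    ∃ c : ℝ, 0 < c ∧
      ∀ (n : ℕ) (δ ε : ℝ),
        (2 : ℝ) ^ (-(n : ℝ) / 2) ≤ δ → δ ≤ 1 →
        Real.sqrt (n : ℝ) * (2 : ℝ) ^ (-(n : ℝ) / 4) ≤ ε → ε ≤ 1 / 2 →
        ∀ (A : GLStar.RandAlg n) (TF TG : ℕ),
          GLStar.Solves δ ε A → GLStar.QueryBound δ ε A TF TG →
            c * (2 : ℝ) ^ ((n : ℝ) / 2) ≤ (TF : ℝ) ∨ c * ((n : ℝ) / ε ^ 2) ≤ (TG : ℝ) :=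
  ⟨1 / 1000, by norm_num, GLStar.query_lower_bound⟩
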